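/- For a prime $p \neq 3$, let $M(\mathbb{F}_p)$ be the set of solutions $(x,y,z) \neq (0,0,0)$ of $x^2+y^2+z^2=xyz$ over $\mathbb{F}_p$. The Markoff graph mod $p$ is the graph (with loops allowed) on $M(\mathbb{F}_p)$ in which $(x,y,z)$ is joined to each of $(yz-x,y,z)$, $(x,xz-y,z)$ and $(x,y,xy-z)$. Let $A$ be its adjacency matrix, with $A_{vw}=1$ if there is an edge between $v$ and $w$ (a loop, if $v=w$) and $A_{vw}=0$ otherwise, let $\lambda_j$ be the eigenvalues of $A$ listed with multiplicity, and let \[ \mu_p = \frac{1}{|M(\mathbb{F}_p)|}\sum_j \delta_{\lambda_j}. \] Let \[ \rho_3(x) = \frac{3}{2\pi}\,\frac{\sqrt{8-x^2}}{9-x^2}\,\mathbf{1}_{[-2\sqrt2,\,2\sqrt2]}(x) \] be the Kesten-McKay density. Then there is an absolute constant $C>1$, and one can take $C=2^{17}$, such that for all primes $p \neq 3$ and all integers $L \geq 0$ \[ \int x^L\,d\mu_p(x) = \int x^L \rho_3(x)\,dx + O\!\left(\frac{C^L}{p}\right), \] where the implied constant is independent of both $p$ and $L$. -/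

import Mathlib

open MeasureTheory
open scoped ENNReal

/-- The vertex set `M(𝔽_p)`: the nonzero solutions of `x² + y² + z² = xyz` over `𝔽_p`. -/
abbrev MarkoffVertex (p : ℕ) : Type :=
  {v : ZMod p × ZMod p × ZMod p //
    v ≠ (0, 0, 0) ∧ v.1 ^ 2 + v.2.1 ^ 2 + v.2.2 ^ 2 = v.1 * v.2.1 * v.2.2}

/-- There is an edge from `(x, y, z)` to each of its images `(yz - x, y, z)`, `(x, xz - y, z)`
and `(x, y, xy - z)`. Loops are allowed: a vertex may be its own image. -/
def MarkoffAdj {p : ℕ} (v w : MarkoffVertex p) : Prop :=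
  w.1 = (v.1.2.1 * v.1.2.2 - v.1.1, v.1.2.1, v.1.2.2) ∨
  w.1 = (v.1.1, v.1.1 * v.1.2.2 - v.1.2.1, v.1.2.2) ∨
  w.1 = (v.1.1, v.1.2.1, v.1.1 * v.1.2.1 - v.1.2.2)

/-- The edges are undirected, because each move is an involution. -/
theorem MarkoffAdj.symm {p : ℕ} {v w : MarkoffVertex p} (h : MarkoffAdj v w) :
    MarkoffAdj w v := by
  obtain ⟨⟨x, y, z⟩, hv⟩ := v
  obtain ⟨⟨x', y', z'⟩, hw⟩ := w
  simp only [MarkoffAdj, Prod.mk.injEq] at h ⊢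
  rcases h with ⟨rfl, rfl, rfl⟩ | ⟨rfl, rfl, rfl⟩ | ⟨rfl, rfl, rfl⟩
  · left; simp
  · right; left; simp
  · right; right; simp

/-- The adjacency matrix of the Markoff graph mod `p`: the entry at `(v, w)` is `1` if there is an
edge between `v` and `w` (a loop, if `v = w`), and `0` otherwise. -/
noncomputable def markoffAdjMatrix (p : ℕ) : Matrix (MarkoffVertex p) (MarkoffVertex p) ℝ :=
  open Classical in Matrix.of fun v w => if MarkoffAdj v w then 1 else 0

theorem markoffAdjMatrix_isHermitian (p : ℕ) : (markoffAdjMatrix p).IsHermitian := by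
  classical
  ext v w
  have h : MarkoffAdj w v ↔ MarkoffAdj v w := ⟨MarkoffAdj.symm, MarkoffAdj.symm⟩
  simp [markoffAdjMatrix, Matrix.conjTranspose_apply, h]

/-- The normalized eigenvalue measure `μ_p = |M(𝔽_p)|⁻¹ ∑_j δ_{λ_j}`, where the `λ_j` are the
eigenvalues of the adjacency matrix, listed with multiplicity. -/
noncomputable def markoffEigenvalueMeasure (p : ℕ) [NeZero p] : Measure ℝ :=
  (Fintype.card (MarkoffVertex p) : ℝ≥0∞)⁻¹ •
    ∑ j : MarkoffVertex p, Measure.dirac ((markoffAdjMatrix_isHermitian p).eigenvalues j)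

/-- The Kesten-McKay density
`ρ_d(t) = d / (2π) * √(4(d - 1) - t²) / (d² - t²)` on `[-2√(d - 1), 2√(d - 1)]`, zero elsewhere. -/
noncomputable def kestenMcKayDensity (d : ℝ) : ℝ → ℝ :=
  Set.indicator (Set.Icc (-(2 * √(d - 1))) (2 * √(d - 1)))
    fun t => d / (2 * Real.pi) * (√(4 * (d - 1) - t ^ 2) / (d ^ 2 - t ^ 2))

/-!
The measure `μ_p` has moments `tr (A ^ L) / |M(𝔽_p)|`. For odd `p` the matrix `A` is the sum of the
permutation matrices of the three Vieta involutions, and these generate an action of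
`ℤ/2 * ℤ/2 * ℤ/2`, whose Cayley graph is the `3`-regular tree. The Kesten-McKay measure is the
spectral measure of that tree, so the claim says that nontrivial reduced words in the involutions
have few fixed points: `O(2 ^ n * p)` for words of length `n`, against `|M(𝔽_p)| ≫ p ^ 2`.

*Fixed points* (`ReducedWord.card_fixed_le`). Let `k` be the first letter of the word to act. The
surface is fibred by the conics `v k = c`. Over an algebraic closure, such a conic is in general
parametrized by `u ≠ 0`, with the other two coordinates Laurent polynomials of degree `1` in `u`.
The first move makes the degrees `(2; 1, 1)`, and from then on each letter of the reduced word
replaces a coordinate by one of larger degree, because the coordinate moved last has the strictly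
largest degree (`ReducedWord.exists_numerator`). In the end the coordinate `k` is a nonconstant
Laurent polynomial in `u`, so it returns to the value `c` for `O(2 ^ n)` values of `u` only
(`ReducedWord.card_le_of_conic`). Summing over `c` gives the bound. The same parametrization bounds
`|M(𝔽_p)|` from below (`le_card_markoffVertex`).

*Comparison of moments.* Let `qₙ` be the non-backtracking polynomials. Then `qₙ(A)` is the sum of
the permutation matrices of the reduced words of length `n`, so its normalized trace is
`O(4 ^ n / p)` for `n ≥ 1`, while `∫ qₙ ρ₃ = 0` (`integral_nonbacktracking`): with `x = 2√2 cos θ`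
this is a statement on the Fourier coefficients of the Poisson kernel `1 / (5 - 4 cos 2θ)`. The
mixed moments of `x ^ L qₙ` under both measures obey the same three-term recurrence in `n`, and
the recurrence carries the error from `L = 0` to all `L` with a factor of at most `8` per step
(`IsMomentArray.abs_le`). This suffices for `p ≥ 11`; the finitely many smaller `p`, among them
`p = 2`, where `A` need not be a sum of permutation matrices, are covered by trivial bounds.
-/

/-! ### Vieta involutions and reduced words -/

/-- The Vieta involution of the `i`-th coordinate of a triple, `xᵢ ↦ xᵢ₊₁ xᵢ₊₂ - xᵢ`, where the
indices are read modulo `3`. -/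
def vietaMove {R : Type*} [CommRing R] (i : Fin 3) (v : Fin 3 → R) : Fin 3 → R :=
  Function.update v i (v (i + 1) * v (i + 2) - v i)

/-- The action of a word in the three Vieta involutions. The head of the list acts last. -/
def vietaWord {R : Type*} [CommRing R] (l : List (Fin 3)) (v : Fin 3 → R) : Fin 3 → R :=
  l.foldr vietaMove v

/-- `ReducedWord k i l` says that `l` is a nonempty word without two equal consecutive letters,
whose first letter to act (the end of the list) is `k` and whose last letter to act (the head of
the list) is `i`. -/
inductive ReducedWord (k : Fin 3) : Fin 3 → List (Fin 3) → Prop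
  | singleton : ReducedWord k k [k]
  | cons {i j : Fin 3} {l : List (Fin 3)} :
      ReducedWord k i l → j ≠ i → ReducedWord k j (j :: l)

section Coordinates

variable {R S : Type*} [CommRing R] [CommRing S]

lemma Fin.eq_or_eq_add_one_or_eq_add_two (k j : Fin 3) : j = k ∨ j = k + 1 ∨ j = k + 2 := by
  revert k j; decide

lemma Fin.add_one_ne_self_three (k : Fin 3) : k + 1 ≠ k := by revert k; decide

lemma Fin.add_two_ne_self_three (k : Fin 3) : k + 2 ≠ k := by revert k; decide

lemma Fin.add_one_add_one_three (k : Fin 3) : k + 1 + 1 = k + 2 := by revert k; decide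

lemma Fin.add_one_add_two_three (k : Fin 3) : k + 1 + 2 = k := by revert k; decide

lemma Fin.add_two_add_one_three (k : Fin 3) : k + 2 + 1 = k := by revert k; decide

lemma map_vietaMove (f : R →+* S) (i : Fin 3) (v : Fin 3 → R) :
    f ∘ vietaMove i v = vietaMove i (f ∘ v) := by
  ext j
  rcases eq_or_ne j i with rfl | h
  · simp [vietaMove]
  · simp [vietaMove, Function.update_of_ne h]

lemma map_vietaWord (f : R →+* S) (l : List (Fin 3)) (v : Fin 3 → R) :
    f ∘ vietaWord l v = vietaWord l (f ∘ v) := by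
  induction l with
  | nil => rfl
  | cons i l ih => simp only [vietaWord, List.foldr_cons] at ih ⊢; rw [map_vietaMove, ih]

end Coordinates

/-! ### Degree growth on the conics `v k = c` -/

section Degree

open Polynomial

variable {K : Type*} [Field K]

/-- A step of the degree computation: if the triple `v` is `Pⱼ(u) / u ^ N`, then its image under
the `i`-th Vieta involution is `Pⱼ'(u) / u ^ (2 N)` for the triple `P'` given here. -/
noncomputable def stepNumerator (N : ℕ) (i : Fin 3) (P : Fin 3 → K[X]) : Fin 3 → K[X] :=
  Function.update (fun j => X ^ N * P j) i (P (i + 1) * P (i + 2) - X ^ N * P i)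

lemma eval_stepNumerator {N : ℕ} {i : Fin 3} {P : Fin 3 → K[X]} {u : K} {v : Fin 3 → K}
    (h : ∀ j, v j * u ^ N = (P j).eval u) (j : Fin 3) :
    vietaMove i v j * u ^ (2 * N) = (stepNumerator N i P j).eval u := by
  rcases eq_or_ne j i with rfl | hj
  · simp only [vietaMove, stepNumerator, Function.update_self, eval_sub, eval_mul, eval_pow,
      eval_X, ← h]
    ring
  · simp only [vietaMove, stepNumerator, Function.update_of_ne hj, eval_mul, eval_pow,
      eval_X, ← h]
    ring

lemma natDegree_stepNumerator_of_ne {N : ℕ} {i j : Fin 3} (hj : j ≠ i) {P : Fin 3 → K[X]}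
    (h : P j ≠ 0) : (stepNumerator N i P j).natDegree = N + (P j).natDegree := by
  rw [stepNumerator, Function.update_of_ne hj, natDegree_mul (pow_ne_zero _ X_ne_zero) h,
    natDegree_X_pow]

lemma natDegree_stepNumerator_self {N : ℕ} {i : Fin 3} {P : Fin 3 → K[X]}
    (h1 : P (i + 1) ≠ 0) (h2 : P (i + 2) ≠ 0)
    (h : N + (P i).natDegree < (P (i + 1)).natDegree + (P (i + 2)).natDegree) :
    (stepNumerator N i P i).natDegree = (P (i + 1)).natDegree + (P (i + 2)).natDegree := by
  rw [stepNumerator, Function.update_self, natDegree_sub_eq_left_of_natDegree_lt,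
    natDegree_mul h1 h2]
  rw [natDegree_mul h1 h2]
  refine lt_of_le_of_lt natDegree_mul_le ?_
  rwa [natDegree_X_pow]

/-- Degree growth along a reduced word. Start from a triple `P₀ⱼ(u) / u` whose coordinate `k` has
degree at most `0` in `u` and whose other two coordinates have degree `1`. After a reduced word
whose first letter is `k`, every coordinate has a positive degree `d j`, and the one moved last
dominates strictly; this makes the next move increase the degree again. -/
lemma ReducedWord.exists_numerator {k i : Fin 3} {l : List (Fin 3)} (hl : ReducedWord k i l)
    {P₀ : Fin 3 → K[X]} (h0 : (P₀ k).natDegree ≤ 1) (h1 : (P₀ (k + 1)).natDegree = 2)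
    (h2 : (P₀ (k + 2)).natDegree = 2) :
    ∃ (P : Fin 3 → K[X]) (d : Fin 3 → ℕ), (∀ j, (P j).natDegree = 2 ^ l.length + d j) ∧
      (∀ j, 0 < d j) ∧ (∀ j, j ≠ i → d j < d i) ∧ (∀ j, d j ≤ 2 ^ l.length) ∧
      ∀ (u : K) (v : Fin 3 → K), (∀ j, v j * u = (P₀ j).eval u) →
        ∀ j, vietaWord l v j * u ^ (2 ^ l.length) = (P j).eval u := by
  induction hl with
  | singleton =>
    have n1 : P₀ (k + 1) ≠ 0 := by rintro h; simp [h] at h1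
    have n2 : P₀ (k + 2) ≠ 0 := by rintro h; simp [h] at h2
    have e0 := natDegree_stepNumerator_self (N := 1) n1 n2 (by omega)
    have e1 := natDegree_stepNumerator_of_ne (N := 1) (Fin.add_one_ne_self_three k) n1
    have e2 := natDegree_stepNumerator_of_ne (N := 1) (Fin.add_two_ne_self_three k) n2
    refine ⟨stepNumerator 1 k P₀, fun j => if j = k then 2 else 1, fun j => ?_, fun j => ?_,
      fun j hj => by simp [hj], fun j => ?_, fun u v huv j => ?_⟩
    · rcases Fin.eq_or_eq_add_one_or_eq_add_two k j with rfl | rfl | rfl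
      · simp [e0, h1, h2]
      · simp [e1, h1]
      · simp [e2, h2]
    · dsimp only; split_ifs <;> simp
    · dsimp only; split_ifs <;> simp
    · exact eval_stepNumerator (N := 1) (by simpa using huv) j
  | @cons i j l hl hji ih =>
    obtain ⟨P, d, hP, hd, hi, hN, hev⟩ := ih
    have n (a : Fin 3) : P a ≠ 0 :=
      ne_zero_of_natDegree_gt (n := 0) (by rw [hP]; exact Nat.add_pos_right _ (hd a))
    -- The letter moved previously is one of the two factors of the product in the next move.
    have hlt : d i < d (j + 1) + d (j + 2) := by
      have a1 := hd (j + 1)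
      have a2 := hd (j + 2)
      rcases Fin.eq_or_eq_add_one_or_eq_add_two j i with rfl | rfl | rfl
      · exact absurd rfl hji
      · omega
      · omega
    have hle (a : Fin 3) : d a ≤ d i := by
      rcases eq_or_ne a i with rfl | h
      · rfl
      · exact (hi a h).le
    have ha := hi j hji
    have e0 := natDegree_stepNumerator_self (N := 2 ^ l.length) (i := j) (n (j + 1)) (n (j + 2))
      (by simp only [hP]; omega)
    refine ⟨stepNumerator (2 ^ l.length) j P,
      Function.update d j (d (j + 1) + d (j + 2)), fun a => ?_, fun a => ?_, fun a hne => ?_,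
      fun a => ?_, fun u v huv a => ?_⟩
    · rw [List.length_cons, pow_succ]
      rcases eq_or_ne a j with rfl | h
      · rw [e0, Function.update_self, hP, hP]; ring
      · rw [natDegree_stepNumerator_of_ne h (n a), Function.update_of_ne h, hP]; ring
    · rcases eq_or_ne a j with rfl | h
      · rw [Function.update_self]; have := hd (a + 1); omega
      · rw [Function.update_of_ne h]; exact hd a
    · rw [Function.update_self, Function.update_of_ne hne]
      exact (hle a).trans_lt hlt
    · rw [List.length_cons, pow_succ]
      rcases eq_or_ne a j with rfl | h
      · rw [Function.update_self]; have := hN (a + 1); have := hN (a + 2); omega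
      · rw [Function.update_of_ne h]; have := hN a; omega
    · rw [List.length_cons, pow_succ, mul_comm (2 ^ _) 2]
      exact eval_stepNumerator (fun b => hev u v huv b) a

/-- The equation `x² + y² + z² = xyz` for a triple, written symmetrically. -/
def IsMarkoffTriple {R : Type*} [CommRing R] (v : Fin 3 → R) : Prop :=
  ∀ i, v i ^ 2 + v (i + 1) ^ 2 + v (i + 2) ^ 2 = v i * v (i + 1) * v (i + 2)

/-- On the conic cut out of the Markoff surface by `v k = c`, with `c = t + t⁻¹`, the function
`u = v (k + 1) - t * v (k + 2)` is a coordinate, in which `v (k + 1)` and `v (k + 2)` are Laurent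
polynomials of degree `1`. A reduced word that begins with the letter `k` makes the coordinate `k`
a Laurent polynomial of positive degree, so that it takes the value `c` at few points only. -/
lemma ReducedWord.card_le_of_conic {K : Type*} [Field K] {k i : Fin 3} {l : List (Fin 3)}
    (hl : ReducedWord k i l) {t c : K} (ht : t ≠ 0) (htt : t ^ 2 ≠ 1) (hc : c ≠ 0)
    (htc : c = t + t⁻¹) (s : Finset (Fin 3 → K))
    (hs : ∀ v ∈ s, IsMarkoffTriple v ∧ v k = c ∧ vietaWord l v k = c) :
    s.card ≤ 2 ^ (l.length + 1) := by
  classical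
  set D : K := t⁻¹ - t with hD
  have hD0 : D ≠ 0 := by
    intro h
    apply htt
    have : t⁻¹ = t := sub_eq_zero.mp h
    calc t ^ 2 = t * t := sq t
      _ = t * t⁻¹ := by rw [this]
      _ = 1 := mul_inv_cancel₀ ht
  let P₀ : Fin 3 → K[X] := fun j =>
    if j = k then C c * X else if j = k + 1 then C (t⁻¹ / D) * X ^ 2 + C (t * c ^ 2 / D)
    else C (1 / D) * X ^ 2 + C (c ^ 2 / D)
  have p0 : P₀ k = C c * X := by simp [P₀]
  have p1 : P₀ (k + 1) = C (t⁻¹ / D) * X ^ 2 + C (t * c ^ 2 / D) := by simp [P₀]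
  have p2 : P₀ (k + 2) = C (1 / D) * X ^ 2 + C (c ^ 2 / D) := by simp [P₀]
  have deg (a b : K) (ha : a ≠ 0) : (C a * X ^ 2 + C b).natDegree = 2 := by
    rw [natDegree_add_C, natDegree_C_mul_X_pow _ _ ha]
  obtain ⟨P, d, hP, hd, -, hN, hev⟩ := hl.exists_numerator (P₀ := P₀)
    (by rw [p0]; simpa using natDegree_C_mul_X_pow_le c 1)
    (by rw [p1]; exact deg _ _ (div_ne_zero (inv_ne_zero ht) hD0))
    (by rw [p2]; exact deg _ _ (div_ne_zero one_ne_zero hD0))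
  set N := 2 ^ l.length with hNdef
  let Q : K[X] := P k - C c * X ^ N
  have hQdeg : Q.natDegree = N + d k := by
    rw [← hP k]
    apply natDegree_sub_eq_left_of_natDegree_lt
    rw [hP, natDegree_C_mul_X_pow _ _ hc]
    have := hd k
    omega
  have hQ0 : Q ≠ 0 :=
    ne_zero_of_natDegree_gt (n := 0) (by rw [hQdeg]; exact Nat.add_pos_right _ (hd k))
  let f : (Fin 3 → K) → K := fun v => v (k + 1) - t * v (k + 2)
  have key : ∀ v ∈ s, f v * (v (k + 1) - t⁻¹ * v (k + 2)) = - c ^ 2 := by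
    intro v hv
    obtain ⟨hM, hk, -⟩ := hs v hv
    have := hM k
    rw [hk, htc] at this
    simp only [f]
    rw [htc]
    linear_combination this + v (k + 2) ^ 2 * mul_inv_cancel₀ ht
  have hu0 : ∀ v ∈ s, f v ≠ 0 := by
    intro v hv h
    have := key v hv
    rw [h, zero_mul] at this
    exact hc (by simpa using this.symm)
  have hparam : ∀ v ∈ s, ∀ j, v j * f v = (P₀ j).eval (f v) := by
    intro v hv j
    have hk := key v hv
    have hy : D * v (k + 2) = f v - (v (k + 1) - t⁻¹ * v (k + 2)) := by simp only [f, hD]; ring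
    have hx : D * v (k + 1) = t⁻¹ * f v - t * (v (k + 1) - t⁻¹ * v (k + 2)) := by
      simp only [f, hD]
      ring
    rcases Fin.eq_or_eq_add_one_or_eq_add_two k j with rfl | rfl | rfl
    · rw [p0, (hs v hv).2.1]; simp
    · rw [p1]
      simp only [eval_add, eval_mul, eval_C, eval_pow, eval_X]
      apply mul_left_cancel₀ hD0
      rw [mul_add, ← mul_assoc, ← mul_assoc, mul_div_cancel₀ _ hD0, mul_div_cancel₀ _ hD0, hx]
      linear_combination (-t) * hk
    · rw [p2]
      simp only [eval_add, eval_mul, eval_C, eval_pow, eval_X]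
      apply mul_left_cancel₀ hD0
      rw [mul_add, ← mul_assoc, ← mul_assoc, mul_div_cancel₀ _ hD0, mul_div_cancel₀ _ hD0, hy]
      linear_combination (-1) * hk
  have hinj : Set.InjOn f s := by
    intro v hv w hw hvw
    ext j
    apply mul_right_cancel₀ (hu0 v hv)
    rw [hparam v hv, hvw, hparam w hw]
  have hmaps : ∀ v ∈ s, f v ∈ Q.roots.toFinset := by
    intro v hv
    rw [Multiset.mem_toFinset, mem_roots hQ0, IsRoot.def]
    have := hev (f v) v (hparam v hv) k
    simp only [Q, eval_sub, eval_mul, eval_C, eval_pow, eval_X, ← this, (hs v hv).2.2, sub_self]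
  calc s.card ≤ Q.roots.toFinset.card := Finset.card_le_card_of_injOn f hmaps hinj
    _ ≤ Multiset.card Q.roots := Multiset.toFinset_card_le _
    _ ≤ Q.natDegree := card_roots' Q
    _ ≤ 2 ^ (l.length + 1) := by rw [hQdeg, pow_succ]; have := hN k; omega

end Degree

/-! ### The action on the vertices of the Markoff graph -/

section Vertices

variable {p : ℕ}

/-- The coordinates of a vertex of the Markoff graph, as a function on `Fin 3`. -/
def MarkoffVertex.coords (v : MarkoffVertex p) : Fin 3 → ZMod p :=
  ![v.1.1, v.1.2.1, v.1.2.2]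

lemma MarkoffVertex.coords_injective :
    Function.Injective (MarkoffVertex.coords : MarkoffVertex p → Fin 3 → ZMod p) := by
  intro v w h
  have h0 := congrFun h 0
  have h1 := congrFun h 1
  have h2 := congrFun h 2
  simp only [MarkoffVertex.coords, Matrix.cons_val_zero, Matrix.cons_val_one, Matrix.cons_val] at *
  exact Subtype.ext (Prod.ext h0 (Prod.ext h1 h2))

lemma MarkoffVertex.isMarkoffTriple_coords (v : MarkoffVertex p) :
    IsMarkoffTriple v.coords := by
  have h := v.2.2
  intro i
  fin_cases i
  · simpa [MarkoffVertex.coords] using h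
  · simp [MarkoffVertex.coords]
    linear_combination h
  · simp [MarkoffVertex.coords]
    linear_combination h

lemma MarkoffVertex.coords_ne_zero (v : MarkoffVertex p) : v.coords ≠ 0 := by
  intro h
  apply v.2.1
  have h0 := congrFun h 0
  have h1 := congrFun h 1
  have h2 := congrFun h 2
  exact Prod.ext h0 (Prod.ext h1 h2)

lemma IsMarkoffTriple.of_zero {R : Type*} [CommRing R] {v : Fin 3 → R}
    (h : v 0 ^ 2 + v 1 ^ 2 + v 2 ^ 2 = v 0 * v 1 * v 2) : IsMarkoffTriple v := by
  intro i
  fin_cases i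
  · simpa using h
  · simp
    linear_combination h
  · simp
    linear_combination h

lemma vietaMove_vietaMove {R : Type*} [CommRing R] (i : Fin 3) (v : Fin 3 → R) :
    vietaMove i (vietaMove i v) = v := by
  ext j
  rcases eq_or_ne j i with rfl | h
  · simp [vietaMove]
  · simp [vietaMove, Function.update_of_ne h]

lemma IsMarkoffTriple.vietaMove {R : Type*} [CommRing R] {v : Fin 3 → R}
    (h : IsMarkoffTriple v) (i : Fin 3) : IsMarkoffTriple (vietaMove i v) := by
  have h0 := h 0
  simp only [zero_add] at h0
  apply IsMarkoffTriple.of_zero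
  fin_cases i <;> simp [_root_.vietaMove, Function.update] <;> linear_combination h0

/-- The vertex with given coordinates. -/
def MarkoffVertex.ofCoords (v : Fin 3 → ZMod p) (h : IsMarkoffTriple v) (h0 : v ≠ 0) :
    MarkoffVertex p :=
  ⟨(v 0, v 1, v 2), by
    refine ⟨fun h' => h0 ?_, by simpa using h 0⟩
    simp only [Prod.mk.injEq] at h'
    ext j
    fin_cases j
    · exact h'.1
    · exact h'.2.1
    · exact h'.2.2⟩

lemma MarkoffVertex.coords_ofCoords (v : Fin 3 → ZMod p) (h : IsMarkoffTriple v) (h0 : v ≠ 0) :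
    (MarkoffVertex.ofCoords v h h0).coords = v := by
  ext j
  fin_cases j <;> rfl

lemma vietaMove_ne_zero {R : Type*} [CommRing R] {v : Fin 3 → R} (h0 : v ≠ 0) (i : Fin 3) :
    vietaMove i v ≠ 0 := by
  intro h
  apply h0
  rw [← vietaMove_vietaMove i v, h]
  ext j
  rcases eq_or_ne j i with rfl | hj
  · simp [vietaMove]
  · simp [vietaMove, Function.update_of_ne hj]

/-- The `i`-th Vieta involution as a permutation of the vertices of the Markoff graph. -/
def vietaPerm (i : Fin 3) : Equiv.Perm (MarkoffVertex p) :=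
  Function.Involutive.toPerm
    (fun v => MarkoffVertex.ofCoords (vietaMove i v.coords) (v.isMarkoffTriple_coords.vietaMove i)
      (vietaMove_ne_zero v.coords_ne_zero i))
    fun v => MarkoffVertex.coords_injective <| by
      simp only [MarkoffVertex.coords_ofCoords, vietaMove_vietaMove]

lemma coords_vietaPerm (i : Fin 3) (v : MarkoffVertex p) :
    (vietaPerm i v).coords = vietaMove i v.coords :=
  MarkoffVertex.coords_ofCoords _ (v.isMarkoffTriple_coords.vietaMove i)
    (vietaMove_ne_zero v.coords_ne_zero i)

/-- The permutation of the vertices given by a word in the Vieta involutions. -/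
def vietaWordPerm (l : List (Fin 3)) : Equiv.Perm (MarkoffVertex p) :=
  (l.map vietaPerm).prod

lemma coords_vietaWordPerm (l : List (Fin 3)) (v : MarkoffVertex p) :
    (vietaWordPerm l v).coords = vietaWord l v.coords := by
  induction l with
  | nil => rfl
  | cons i l ih =>
    rw [vietaWordPerm, List.map_cons, List.prod_cons, Equiv.Perm.mul_apply, coords_vietaPerm,
      vietaWord, List.foldr_cons]
    exact congrArg _ ih

lemma markoffAdj_iff {v w : MarkoffVertex p} :
    MarkoffAdj v w ↔ ∃ i, vietaPerm i v = w := by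
  have key (i : Fin 3) : vietaPerm i v = w ↔ w.coords = vietaMove i v.coords := by
    rw [← coords_vietaPerm, MarkoffVertex.coords_injective.eq_iff, eq_comm]
  have hw : ∀ f : Fin 3 → ZMod p, w.coords = f ↔ w.1 = (f 0, f 1, f 2) := by
    intro f
    constructor
    · rintro rfl; rfl
    · intro h
      ext j
      fin_cases j <;> simp [MarkoffVertex.coords, h]
  simp only [key, hw, MarkoffAdj]
  simp [Fin.exists_fin_succ, vietaMove, MarkoffVertex.coords, mul_comm]

end Vertices

/-! ### Counting fixed points and vertices -/

section Counting

open Polynomial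

lemma card_le_two_of_quadratic {F : Type*} [Field F] (a b : F) (s : Finset F)
    (h : ∀ x ∈ s, x ^ 2 + a * x + b = 0) : s.card ≤ 2 := by
  classical
  let Q : F[X] := X ^ 2 + C a * X + C b
  have hdeg : Q.natDegree = 2 := by simp only [Q]; compute_degree!
  have hQ0 : Q ≠ 0 := ne_zero_of_natDegree_gt (n := 0) (by omega)
  calc s.card ≤ Q.roots.toFinset.card := Finset.card_le_card fun x hx => by
        rw [Multiset.mem_toFinset, mem_roots hQ0, IsRoot.def]
        simpa [Q] using h x hx
    _ ≤ Multiset.card Q.roots := Multiset.toFinset_card_le _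
    _ ≤ 2 := hdeg ▸ card_roots' Q

variable {p : ℕ}

lemma MarkoffVertex.coords_ext {k : Fin 3} {v w : MarkoffVertex p}
    (h0 : v.coords k = w.coords k) (h1 : v.coords (k + 1) = w.coords (k + 1))
    (h2 : v.coords (k + 2) = w.coords (k + 2)) : v = w := by
  apply MarkoffVertex.coords_injective
  ext j
  rcases Fin.eq_or_eq_add_one_or_eq_add_two k j with rfl | rfl | rfl
  · exact h0
  · exact h1
  · exact h2

/-- Each plane section of the Markoff surface by a coordinate plane has at most `2p` points, since
two coordinates determine the third up to two choices. -/
lemma card_filter_coords_eq_le [Fact p.Prime] (k : Fin 3) (c : ZMod p)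
    (s : Finset (MarkoffVertex p))
    (hs : ∀ v ∈ s, v.coords k = c) : s.card ≤ 2 * p := by
  classical
  have : s.card ≤ 2 * (Finset.univ : Finset (ZMod p)).card := by
    refine Finset.card_le_mul_card_image_of_maps_to (f := fun v => v.coords (k + 1))
      (fun _ _ => Finset.mem_univ _) 2 fun y _ => ?_
    rw [← Finset.card_image_of_injOn (f := fun v : MarkoffVertex p => v.coords (k + 2))]
    · refine card_le_two_of_quadratic (-(c * y)) (c ^ 2 + y ^ 2) _ fun x hx => ?_
      obtain ⟨v, hv, rfl⟩ := Finset.mem_image.mp hx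
      obtain ⟨hvs, hvy⟩ := Finset.mem_filter.mp hv
      have := v.isMarkoffTriple_coords k
      rw [hs v hvs, hvy] at this
      linear_combination this
    · intro v hv w hw hvw
      obtain ⟨hvs, hvy⟩ := Finset.mem_filter.mp (Finset.mem_coe.mp hv)
      obtain ⟨hws, hwy⟩ := Finset.mem_filter.mp (Finset.mem_coe.mp hw)
      exact MarkoffVertex.coords_ext ((hs v hvs).trans (hs w hws).symm) (hvy.trans hwy.symm) hvw
  rwa [Finset.card_univ, ZMod.card] at this

/-- A nontrivial reduced word fixes `O(2 ^ length * p)` vertices: the conics on which the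
coordinate of its first letter equals `c` contribute `O(2 ^ length)` each, apart from the three
values `c = 0, 2, -2`, for which the number of points of the conic is used instead. The splitting
field of the conic is not always `𝔽_p`, so the points are counted over an algebraic closure. -/
lemma ReducedWord.card_fixed_le {k i : Fin 3} {l : List (Fin 3)} (hl : ReducedWord k i l)
    [Fact p.Prime] [DecidableEq (MarkoffVertex p)] :
    (Finset.univ.filter fun v : MarkoffVertex p => vietaWordPerm l v = v).card
      ≤ 2 ^ (l.length + 3) * p := by
  classical
  set s := Finset.univ.filter fun v : MarkoffVertex p => vietaWordPerm l v = v with hs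
  let K := AlgebraicClosure (ZMod p)
  let e : Finset (ZMod p) := {0, 2, -2}
  have hgen (c : ZMod p) (hc : c ∉ e) :
      (s.filter fun v => v.coords k = c).card ≤ 2 ^ (l.length + 1) := by
    simp only [e, Finset.mem_insert, Finset.mem_singleton, not_or] at hc
    obtain ⟨hc0, hc2, hc2'⟩ := hc
    let φ : ZMod p →+* K := algebraMap (ZMod p) K
    obtain ⟨t, ht⟩ := IsAlgClosed.exists_root (X ^ 2 - C (φ c) * X + 1 : K[X]) (by
      have : (X ^ 2 - C (φ c) * X + 1 : K[X]).degree = 2 := by compute_degree!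
      rw [this]; norm_num)
    have ht' : t ^ 2 - φ c * t + 1 = 0 := by simpa [IsRoot.def] using ht
    have ht0 : t ≠ 0 := by rintro rfl; simp at ht'
    have htt : t ^ 2 ≠ 1 := by
      intro h
      rcases sq_eq_sq_iff_eq_or_eq_neg.mp (h.trans (one_pow 2).symm) with rfl | rfl
      · apply hc2; apply φ.injective; rw [map_ofNat]; linear_combination -ht'
      · apply hc2'; apply φ.injective; rw [map_neg, map_ofNat]; linear_combination ht'
    have htc : φ c = t + t⁻¹ := by
      apply mul_right_cancel₀ ht0
      rw [add_mul, inv_mul_cancel₀ ht0]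
      linear_combination -ht'
    have hφ : Function.Injective fun v : MarkoffVertex p => φ ∘ v.coords :=
      (φ.injective.comp_left).comp MarkoffVertex.coords_injective
    rw [← Finset.card_image_of_injective _ hφ]
    refine hl.card_le_of_conic ht0 htt (by simpa using hc0) htc _ fun x hx => ?_
    obtain ⟨v, hv, rfl⟩ := Finset.mem_image.mp hx
    obtain ⟨hvs, hvc⟩ := Finset.mem_filter.mp hv
    refine ⟨fun j => ?_, by simp [hvc], ?_⟩
    · simpa using congrArg φ (v.isMarkoffTriple_coords j)
    · have : vietaWord l v.coords = v.coords := by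
        rw [← coords_vietaWordPerm, (Finset.mem_filter.mp hvs).2]
      rw [← map_vietaWord, this, Function.comp_apply, hvc]
  have hcard : e.card ≤ 3 := Finset.card_le_three
  calc s.card = ∑ c, (s.filter fun v => v.coords k = c).card :=
        Finset.card_eq_sum_card_fiberwise fun _ _ => Finset.mem_univ _
    _ ≤ ∑ c : ZMod p, (2 ^ (l.length + 1) + if c ∈ e then 2 * p else 0) := by
        refine Finset.sum_le_sum fun c _ => ?_
        split_ifs with h
        · exact (card_filter_coords_eq_le k c _ fun v hv => (Finset.mem_filter.mp hv).2).trans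
            (Nat.le_add_left _ _)
        · exact hgen c h
    _ = p * 2 ^ (l.length + 1) + e.card * (2 * p) := by
        rw [Finset.sum_add_distrib, Finset.sum_const, Finset.card_univ, ZMod.card, smul_eq_mul,
          Finset.sum_ite_mem, Finset.univ_inter, Finset.sum_const, smul_eq_mul]
    _ ≤ p * 2 ^ (l.length + 1) + 3 * (2 * p) := by gcongr
    _ = p * (2 ^ (l.length + 1) + 6) := by ring
    _ ≤ p * 2 ^ (l.length + 3) := by
        gcongr
        have : 1 ≤ 2 ^ l.length := Nat.one_le_two_pow
        rw [pow_add, pow_add]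
        omega
    _ = 2 ^ (l.length + 3) * p := mul_comm _ _

/-- The Markoff surface has at least of the order of `p²` points: every `t` with `t⁴ ≠ 1`
and every `u ≠ 0` give a point with `x = t + t⁻¹`, and a point arises from at most two
pairs `(t, u)`. For `p ≤ 5` the truncated subtraction makes the bound trivial. -/
lemma le_card_markoffVertex [Fact p.Prime] :
    (p - 5) * (p - 1) ≤ 2 * Fintype.card (MarkoffVertex p) := by
  classical
  let A : Finset (ZMod p) := Finset.univ.filter fun t => t ≠ 0 ∧ t ^ 2 ≠ 1 ∧ t ^ 2 ≠ -1
  let B : Finset (ZMod p) := Finset.univ.filter fun u => u ≠ 0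
  have hA : p - 5 ≤ A.card := by
    have h1 : (Finset.univ.filter fun t : ZMod p => t ^ 2 = 1).card ≤ 2 :=
      card_le_two_of_quadratic 0 (-1) _ fun x hx => by
        have := (Finset.mem_filter.mp hx).2
        linear_combination this
    have h2 : (Finset.univ.filter fun t : ZMod p => t ^ 2 = -1).card ≤ 2 :=
      card_le_two_of_quadratic 0 1 _ fun x hx => by
        have := (Finset.mem_filter.mp hx).2
        linear_combination this
    have h3 : (Finset.univ : Finset (ZMod p)) ⊆ A ∪ ({0} ∪
        ((Finset.univ.filter fun t : ZMod p => t ^ 2 = 1) ∪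
        (Finset.univ.filter fun t : ZMod p => t ^ 2 = -1))) := by
      intro t _
      simp only [A, Finset.mem_union, Finset.mem_filter, Finset.mem_univ, true_and,
        Finset.mem_singleton]
      tauto
    have h4 := (Finset.card_le_card h3).trans (Finset.card_union_le _ _)
    have h5 := Finset.card_union_le {0} ((Finset.univ.filter fun t : ZMod p => t ^ 2 = 1) ∪
        (Finset.univ.filter fun t : ZMod p => t ^ 2 = -1))
    have h6 := Finset.card_union_le (Finset.univ.filter fun t : ZMod p => t ^ 2 = 1)
        (Finset.univ.filter fun t : ZMod p => t ^ 2 = -1)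
    rw [Finset.card_univ, ZMod.card] at h4
    rw [Finset.card_singleton] at h5
    omega
  have hB : p - 1 ≤ B.card := by
    have : B = Finset.univ.erase 0 := by ext; simp [B]
    rw [this, Finset.card_erase_of_mem (Finset.mem_univ _), Finset.card_univ, ZMod.card]
  let f : ZMod p × ZMod p → Fin 3 → ZMod p := fun a =>
    ![a.1 + a.1⁻¹,
      (a.1⁻¹ * a.2 + a.1 * ((a.1 + a.1⁻¹) ^ 2 / a.2)) / (a.1⁻¹ - a.1),
      (a.2 + (a.1 + a.1⁻¹) ^ 2 / a.2) / (a.1⁻¹ - a.1)]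
  have hD : ∀ t ∈ A, t⁻¹ - t ≠ 0 := by
    intro t ht h
    obtain ⟨h0, h1, -⟩ := (Finset.mem_filter.mp ht).2
    apply h1
    have : t * (t⁻¹ - t) = 0 := by rw [h, mul_zero]
    rw [mul_sub, mul_inv_cancel₀ h0] at this
    linear_combination -this
  -- The pair `(t, u)` is recovered from `t` and the point.
  have hu : ∀ a ∈ A ×ˢ B, a.2 = f a 1 - a.1 * f a 2 := by
    rintro ⟨t, u⟩ ha
    obtain ⟨ht, hu⟩ := Finset.mem_product.mp ha
    have := hD t ht
    simp only [f, Matrix.cons_val_one, Matrix.cons_val_zero, Matrix.cons_val]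
    rw [← mul_div_assoc t (u + _), ← sub_div, eq_div_iff this]
    ring
  have hM : ∀ a ∈ A ×ˢ B, IsMarkoffTriple (f a) := by
    rintro ⟨t, u⟩ ha
    obtain ⟨ht, hu⟩ := Finset.mem_product.mp ha
    have hd := hD t ht
    have ht0 : t ≠ 0 := (Finset.mem_filter.mp ht).2.1
    have hu0 : u ≠ 0 := (Finset.mem_filter.mp hu).2
    apply IsMarkoffTriple.of_zero
    simp only [f, Matrix.cons_val_one, Matrix.cons_val_zero, Matrix.cons_val]
    have hd' : 1 - t ^ 2 ≠ 0 := by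
      intro h
      apply hd
      apply mul_left_cancel₀ ht0
      rw [mul_sub, mul_inv_cancel₀ ht0]
      linear_combination h
    have : t⁻¹ - t = (1 - t ^ 2) / t := by field_simp
    rw [this]
    field_simp
    ring
  have h0 : ∀ a ∈ A ×ˢ B, f a ≠ 0 := by
    rintro ⟨t, u⟩ ha h
    obtain ⟨h0, -, h2⟩ := (Finset.mem_filter.mp (Finset.mem_product.mp ha).1).2
    apply h2
    have : t * (t + t⁻¹) = 0 := by
      have : t + t⁻¹ = 0 := by simpa [f] using congrFun h 0
      rw [this, mul_zero]
    rw [mul_add, mul_inv_cancel₀ h0] at this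
    linear_combination this
  calc (p - 5) * (p - 1) ≤ A.card * B.card := Nat.mul_le_mul hA hB
    _ = (A ×ˢ B).card := (Finset.card_product A B).symm
    _ ≤ 2 * (Finset.univ.image (MarkoffVertex.coords (p := p))).card := by
        refine Finset.card_le_mul_card_image_of_maps_to (f := f) (fun a ha => ?_) 2 fun x _ => ?_
        · exact Finset.mem_image.mpr ⟨.ofCoords (f a) (hM a ha) (h0 a ha), Finset.mem_univ _,
            MarkoffVertex.coords_ofCoords _ _ _⟩
        · rw [← Finset.card_image_of_injOn (f := Prod.fst)]
          · refine card_le_two_of_quadratic (-x 0) 1 _ fun t ht => ?_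
            obtain ⟨a, ha, rfl⟩ := Finset.mem_image.mp ht
            obtain ⟨haAB, rfl⟩ := Finset.mem_filter.mp ha
            have ht0 : a.1 ≠ 0 :=
              (Finset.mem_filter.mp (Finset.mem_product.mp haAB).1).2.1
            simp only [f, Matrix.cons_val_zero]
            linear_combination -mul_inv_cancel₀ ht0
          · intro a ha b hb hab
            obtain ⟨ha, hax⟩ := Finset.mem_filter.mp (Finset.mem_coe.mp ha)
            obtain ⟨hb, hbx⟩ := Finset.mem_filter.mp (Finset.mem_coe.mp hb)
            exact Prod.ext hab (by rw [hu a ha, hu b hb, hax, hbx, hab])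
    _ = 2 * Fintype.card (MarkoffVertex p) := by
        rw [Finset.card_image_of_injective _ MarkoffVertex.coords_injective, Finset.card_univ]

end Counting

/-! ### Moments of the Kesten-McKay measure -/

open Real in
lemma sq_lt_nine_of_mem {x : ℝ} (hx : x ∈ Set.Icc (-(2 * √2)) (2 * √2)) : 0 < 9 - x ^ 2 := by
  have h2 : √2 ^ 2 = 2 := Real.sq_sqrt (by norm_num)
  nlinarith [hx.1, hx.2]

open Real in
/-- The Kesten-McKay measure of degree `3` in the variable `θ` with `x = 2√2 cos θ`. -/
lemma integral_kestenMcKay {F : ℝ → ℝ} (hF : Continuous F) :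
    ∫ x, F x * kestenMcKayDensity 3 x =
      ∫ θ in (0 : ℝ)..π, F (2 * √2 * cos θ) * (12 / π * (sin θ ^ 2 / (9 - 8 * cos θ ^ 2))) := by
  have h2 : √2 ^ 2 = 2 := Real.sq_sqrt (by norm_num)
  have hpos : (0 : ℝ) ≤ √2 := Real.sqrt_nonneg 2
  set G : ℝ → ℝ := fun x => F x * (3 / (2 * π) * (√(8 - x ^ 2) / (9 - x ^ 2))) with hG
  have e1 : ∫ x, F x * kestenMcKayDensity 3 x = ∫ x in (-(2 * √2))..(2 * √2), G x := by
    rw [intervalIntegral.integral_of_le (by linarith), ← integral_Icc_eq_integral_Ioc,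
      ← integral_indicator measurableSet_Icc]
    congr 1
    ext x
    simp only [kestenMcKayDensity, hG, Set.indicator_apply]
    norm_num
  have e2 := intervalIntegral.integral_comp_mul_deriv' (a := 0) (b := π)
    (f := fun θ => 2 * √2 * cos θ) (f' := fun θ => 2 * √2 * (-sin θ)) (g := G)
    (fun θ _ => (hasDerivAt_cos θ).const_mul _) (by fun_prop) (by
      apply ContinuousOn.mul hF.continuousOn
      apply ContinuousOn.mul continuousOn_const
      apply ContinuousOn.div (by fun_prop) (by fun_prop)
      rintro x ⟨θ, -, rfl⟩
      apply (sq_lt_nine_of_mem _).ne'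
      have := neg_one_le_cos θ
      have := cos_le_one θ
      constructor <;> nlinarith)
  simp only [cos_zero, cos_pi, mul_one, mul_neg, Function.comp_def] at e2
  rw [e1, intervalIntegral.integral_symm, ← e2, ← intervalIntegral.integral_neg]
  refine intervalIntegral.integral_congr fun θ hθ => ?_
  rw [Set.uIcc_of_le pi_pos.le] at hθ
  have hs := sin_nonneg_of_mem_Icc hθ
  have hsqrt : √(8 - (2 * √2 * cos θ) ^ 2) = 2 * √2 * sin θ := by
    rw [show 8 - (2 * √2 * cos θ) ^ 2 = (2 * √2 * sin θ) ^ 2 by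
      rw [mul_pow, mul_pow, mul_pow, mul_pow, h2, sin_sq]; ring]
    exact Real.sqrt_sq (by positivity)
  have hden : (2 * √2 * cos θ) ^ 2 = 8 * cos θ ^ 2 := by rw [mul_pow, mul_pow, h2]; ring
  simp only [hG]
  rw [hsqrt, hden]
  have hp := pi_ne_zero
  rw [← sub_eq_zero]
  field_simp
  linear_combination 6 * F (2 * √2 * cos θ) * sin θ ^ 2 * (9 - 8 * cos θ ^ 2)⁻¹ * h2

open Real in
lemma one_le_nine_sub (θ : ℝ) : 1 ≤ 9 - 8 * cos θ ^ 2 := by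
  nlinarith [neg_one_le_cos θ, cos_le_one θ]

open Real in
/-- Fourier coefficients of the Poisson kernel `1 / (5 - 4 cos 2θ) = 1 / (9 - 8 cos² θ)`. -/
noncomputable def poissonCoeff (n : ℕ) : ℝ :=
  ∫ θ in (0 : ℝ)..π, cos (n * θ) / (9 - 8 * cos θ ^ 2)

open Real in
lemma continuous_div_nine_sub {f : ℝ → ℝ} (hf : Continuous f) :
    Continuous fun θ => f θ / (9 - 8 * cos θ ^ 2) :=
  hf.div (by fun_prop) fun θ => (zero_lt_one.trans_le (one_le_nine_sub θ)).ne'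

open Real in
lemma intervalIntegrable_poisson (n : ℕ) (a b : ℝ) :
    IntervalIntegrable (fun θ => cos (n * θ) / (9 - 8 * cos θ ^ 2)) volume a b :=
  (continuous_div_nine_sub (by fun_prop)).intervalIntegrable _ _

open Real in
lemma abs_poissonCoeff_le (n : ℕ) : |poissonCoeff n| ≤ π := by
  have := intervalIntegral.norm_integral_le_of_norm_le_const (a := 0) (b := π) (C := 1)
    (f := fun θ => cos (n * θ) / (9 - 8 * cos θ ^ 2)) fun θ _ => by
      have h := one_le_nine_sub θ
      rw [norm_div, Real.norm_eq_abs, Real.norm_eq_abs, abs_of_pos (zero_lt_one.trans_le h)]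
      exact div_le_one_of_le₀ ((abs_cos_le_one _).trans h) (by linarith)
  simpa [poissonCoeff, abs_of_pos pi_pos] using this

open Real in
lemma cos_add_four_relation (m : ℕ) (θ : ℝ) :
    5 * cos ((m + 2 : ℕ) * θ) - 2 * cos ((m + 4 : ℕ) * θ) - 2 * cos (m * θ)
      = cos ((m + 2 : ℕ) * θ) * (9 - 8 * cos θ ^ 2) := by
  have a1 : ((m + 4 : ℕ) : ℝ) * θ = (m + 2 : ℕ) * θ + 2 * θ := by push_cast; ring
  have a2 : (m : ℝ) * θ = (m + 2 : ℕ) * θ - 2 * θ := by push_cast; ring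
  rw [a1, a2, cos_add, cos_sub, cos_two_mul]
  ring

open Real in
lemma integral_cos_nat_mul (n : ℕ) (hn : n ≠ 0) : ∫ θ in (0 : ℝ)..π, cos (n * θ) = 0 := by
  rw [intervalIntegral.integral_comp_mul_left (fun x => cos x) (by exact_mod_cast hn)]
  simp [sin_nat_mul_pi]

open Real in
lemma poissonCoeff_recurrence (m : ℕ) :
    5 * poissonCoeff (m + 2) = 2 * poissonCoeff (m + 4) + 2 * poissonCoeff m := by
  have h : ∫ θ in (0 : ℝ)..π, (5 * (cos ((m + 2 : ℕ) * θ) / (9 - 8 * cos θ ^ 2))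
      - 2 * (cos ((m + 4 : ℕ) * θ) / (9 - 8 * cos θ ^ 2))
      - 2 * (cos (m * θ) / (9 - 8 * cos θ ^ 2))) = 0 := by
    refine Eq.trans ?_ (integral_cos_nat_mul (m + 2) (by omega))
    congr 1
    ext θ
    have h := (zero_lt_one.trans_le (one_le_nine_sub θ)).ne'
    rw [← mul_div_assoc, ← mul_div_assoc, ← mul_div_assoc, ← sub_div, ← sub_div,
      cos_add_four_relation, mul_div_cancel_right₀ _ h]
  rw [intervalIntegral.integral_sub, intervalIntegral.integral_sub,
    intervalIntegral.integral_const_mul, intervalIntegral.integral_const_mul,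
    intervalIntegral.integral_const_mul] at h
  · simp only [poissonCoeff]; linarith
  all_goals first
    | exact (intervalIntegrable_poisson _ _ _).const_mul _
    | exact ((intervalIntegrable_poisson _ _ _).const_mul _).sub
        ((intervalIntegrable_poisson _ _ _).const_mul _)

open Real in
lemma poissonCoeff_zero_relation : 5 * poissonCoeff 0 - 4 * poissonCoeff 2 = π := by
  have h : ∫ θ in (0 : ℝ)..π, (5 * (cos ((0 : ℕ) * θ) / (9 - 8 * cos θ ^ 2))
      - 4 * (cos ((2 : ℕ) * θ) / (9 - 8 * cos θ ^ 2))) = π := by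
    refine Eq.trans ?_ (show ∫ _ in (0 : ℝ)..π, (1 : ℝ) = π by simp)
    congr 1
    ext θ
    have h := (zero_lt_one.trans_le (one_le_nine_sub θ)).ne'
    rw [← mul_div_assoc, ← mul_div_assoc, ← sub_div, div_eq_one_iff_eq h]
    push_cast
    rw [zero_mul, cos_zero, cos_two_mul]
    ring
  rw [intervalIntegral.integral_sub, intervalIntegral.integral_const_mul,
    intervalIntegral.integral_const_mul] at h
  · exact h
  all_goals exact (intervalIntegrable_poisson _ _ _).const_mul _

/-- The recurrence has the solutions `2 ^ (n / 2)` and `2 ^ (-n / 2)`, and only the second one is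
bounded. -/
lemma poissonCoeff_add_two (m : ℕ) : poissonCoeff (m + 2) = poissonCoeff m / 2 := by
  have hgrow (j : ℕ) : poissonCoeff (m + 2 * j + 2) - poissonCoeff (m + 2 * j) / 2
      = 2 ^ j * (poissonCoeff (m + 2) - poissonCoeff m / 2) := by
    induction j with
    | zero => simp
    | succ j ih =>
      have := poissonCoeff_recurrence (m + 2 * j)
      rw [pow_succ, mul_right_comm, ← ih, show m + 2 * (j + 1) + 2 = m + 2 * j + 4 by ring,
        show m + 2 * (j + 1) = m + 2 * j + 2 by ring]
      linarith
  by_contra hne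
  have hpos : 0 < |poissonCoeff (m + 2) - poissonCoeff m / 2| :=
    abs_pos.mpr (sub_ne_zero.mpr hne)
  obtain ⟨j, hj⟩ := pow_unbounded_of_one_lt
    (2 * Real.pi / |poissonCoeff (m + 2) - poissonCoeff m / 2|) (one_lt_two (α := ℝ))
  rw [div_lt_iff₀ hpos] at hj
  have h1 := abs_poissonCoeff_le (m + 2 * j + 2)
  have h2 := abs_poissonCoeff_le (m + 2 * j)
  have h3 : |(2 : ℝ) ^ j * (poissonCoeff (m + 2) - poissonCoeff m / 2)| ≤ 2 * Real.pi := by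
    rw [← hgrow, abs_le]
    rw [abs_le] at h1 h2
    constructor <;> linarith [Real.pi_pos]
  rw [abs_mul, abs_of_pos (by positivity)] at h3
  linarith

lemma poissonCoeff_zero : poissonCoeff 0 = Real.pi / 3 := by
  have h1 := poissonCoeff_zero_relation
  have h2 := poissonCoeff_add_two 0
  rw [zero_add] at h2
  linarith

open Real in
lemma poissonCoeff_one : poissonCoeff 1 = 0 := by
  have h : ∫ θ in (0 : ℝ)..π, (5 * (cos ((1 : ℕ) * θ) / (9 - 8 * cos θ ^ 2))
      - 2 * (cos ((3 : ℕ) * θ) / (9 - 8 * cos θ ^ 2))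
      - 2 * (cos ((1 : ℕ) * θ) / (9 - 8 * cos θ ^ 2))) = 0 := by
    refine Eq.trans ?_ (integral_cos_nat_mul 1 one_ne_zero)
    congr 1
    ext θ
    have h := (zero_lt_one.trans_le (one_le_nine_sub θ)).ne'
    rw [← mul_div_assoc, ← mul_div_assoc, ← mul_div_assoc, ← sub_div, ← sub_div,
      div_eq_iff h]
    push_cast
    rw [cos_three_mul, one_mul]
    ring
  rw [intervalIntegral.integral_sub, intervalIntegral.integral_sub,
    intervalIntegral.integral_const_mul, intervalIntegral.integral_const_mul,
    intervalIntegral.integral_const_mul] at h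
  · have h3 := poissonCoeff_add_two 1
    simp only [Nat.reduceAdd] at h3
    change 5 * poissonCoeff 1 - 2 * poissonCoeff 3 - 2 * poissonCoeff 1 = 0 at h
    linarith
  all_goals first
    | exact (intervalIntegrable_poisson _ _ _).const_mul _
    | exact ((intervalIntegrable_poisson _ _ _).const_mul _).sub
        ((intervalIntegrable_poisson _ _ _).const_mul _)

/-- The non-backtracking polynomials of the `3`-regular tree: on the adjacency operator of the
tree, `nonbacktracking n` counts the paths of length `n` without backtracking. -/
def nonbacktracking : ℕ → ℝ → ℝ
  | 0, _ => 1
  | 1, x => x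
  | 2, x => x ^ 2 - 3
  | n + 3, x => x * nonbacktracking (n + 2) x - 2 * nonbacktracking (n + 1) x

lemma continuous_nonbacktracking : ∀ n, Continuous (nonbacktracking n)
  | 0 => continuous_const
  | 1 => continuous_id
  | 2 => by change Continuous fun x : ℝ => x ^ 2 - 3; fun_prop
  | n + 3 => by
    have h1 := continuous_nonbacktracking (n + 2)
    have h2 := continuous_nonbacktracking (n + 1)
    change Continuous fun x : ℝ =>
      x * nonbacktracking (n + 2) x - 2 * nonbacktracking (n + 1) x
    fun_prop

open Real in
/-- On `x = 2√2 cos θ` the non-backtracking polynomial of degree `n ≥ 1` is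
`√2 ^ n (Uₙ(cos θ) - Uₙ₋₂(cos θ) / 2)`, where `Uₙ` is the Chebyshev polynomial of the second
kind. -/
lemma nonbacktracking_mul_sin (θ : ℝ) : ∀ n : ℕ,
    nonbacktracking (n + 1) (2 * √2 * cos θ) * sin θ
      = √2 ^ (n + 1) * (sin ((n + 2 : ℕ) * θ) - sin (n * θ) / 2)
  | 0 => by
    simp only [nonbacktracking, zero_add, pow_one]
    push_cast
    rw [zero_mul, sin_zero, sin_two_mul]
    ring
  | 1 => by
    have h2 : √2 ^ 2 = 2 := Real.sq_sqrt (by norm_num)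
    simp only [nonbacktracking, Nat.reduceAdd]
    push_cast
    rw [one_mul, sin_three_mul, mul_pow, mul_pow, h2, cos_sq']
    ring
  | n + 2 => by
    have h2 : √2 ^ 2 = 2 := Real.sq_sqrt (by norm_num)
    have i1 := nonbacktracking_mul_sin θ n
    have i2 := nonbacktracking_mul_sin θ (n + 1)
    have s1 : sin ((n + 2 + 2 : ℕ) * θ)
        = 2 * cos θ * sin ((n + 1 + 2 : ℕ) * θ) - sin ((n + 2 : ℕ) * θ) := by
      rw [show ((n + 2 + 2 : ℕ) : ℝ) * θ = (n + 1 + 2 : ℕ) * θ + θ by push_cast; ring,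
        show ((n + 2 : ℕ) : ℝ) * θ = (n + 1 + 2 : ℕ) * θ - θ by push_cast; ring,
        sin_add, sin_sub]
      ring
    have s2 : sin ((n + 2 : ℕ) * θ) = 2 * cos θ * sin ((n + 1 : ℕ) * θ) - sin (n * θ) := by
      rw [show ((n + 2 : ℕ) : ℝ) * θ = (n + 1 : ℕ) * θ + θ by push_cast; ring,
        show (n : ℝ) * θ = (n + 1 : ℕ) * θ - θ by push_cast; ring, sin_add, sin_sub]
      ring
    have e : √2 ^ (n + 2 + 1) = 2 * √2 ^ (n + 1) := by linear_combination √2 ^ (n + 1) * h2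
    have e' : √2 ^ (n + 1 + 1) = √2 * √2 ^ (n + 1) := by ring
    rw [e'] at i2
    rw [show nonbacktracking (n + 2 + 1) (2 * √2 * cos θ) = 2 * √2 * cos θ *
      nonbacktracking (n + 1 + 1) (2 * √2 * cos θ) -
        2 * nonbacktracking (n + 1) (2 * √2 * cos θ) from rfl, e, s1]
    rw [sub_mul, mul_assoc (2 * √2 * cos θ), i2, mul_assoc 2 (nonbacktracking _ _), i1]
    have s2' : sin (n * θ) = 2 * cos θ * sin ((n + 1 : ℕ) * θ) - sin ((n + 2 : ℕ) * θ) := by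
      linarith
    rw [s2']
    linear_combination (2 * cos θ * √2 ^ (n + 1) * (sin ((n + 1 + 2 : ℕ) * θ) -
      sin ((n + 1 : ℕ) * θ) / 2)) * h2

open Real in
/-- Orthogonality of the non-backtracking polynomials to the constants. -/
lemma integral_nonbacktracking (n : ℕ) :
    ∫ x, nonbacktracking n x * kestenMcKayDensity 3 x = if n = 0 then 1 else 0 := by
  rw [integral_kestenMcKay (continuous_nonbacktracking n)]
  rcases n with _ | n
  · have : ∀ θ : ℝ, nonbacktracking 0 (2 * √2 * cos θ) *
        (12 / π * (sin θ ^ 2 / (9 - 8 * cos θ ^ 2)))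
        = 6 / π * (cos ((0 : ℕ) * θ) / (9 - 8 * cos θ ^ 2)
          - cos ((2 : ℕ) * θ) / (9 - 8 * cos θ ^ 2)) := by
      intro θ
      rw [← sub_div]
      push_cast
      rw [zero_mul, cos_zero, cos_two_mul, sin_sq]
      simp only [nonbacktracking]
      ring
    simp only [this]
    rw [intervalIntegral.integral_const_mul, intervalIntegral.integral_sub
      (intervalIntegrable_poisson _ _ _) (intervalIntegrable_poisson _ _ _)]
    change 6 / π * (poissonCoeff 0 - poissonCoeff 2) = _
    have h2 := poissonCoeff_add_two 0
    rw [zero_add] at h2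
    rw [h2, poissonCoeff_zero]
    have := pi_ne_zero
    field_simp
    norm_num
  · have key : ∀ θ : ℝ, nonbacktracking (n + 1) (2 * √2 * cos θ) *
        (12 / π * (sin θ ^ 2 / (9 - 8 * cos θ ^ 2)))
        = (12 / π * √2 ^ (n + 1)) *
          ((sin θ * sin ((n + 2 : ℕ) * θ) - sin θ * sin (n * θ) / 2) / (9 - 8 * cos θ ^ 2)) := by
      intro θ
      calc _ = 12 / π * (nonbacktracking (n + 1) (2 * √2 * cos θ) * sin θ) *
            (sin θ / (9 - 8 * cos θ ^ 2)) := by ring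
        _ = _ := by rw [nonbacktracking_mul_sin]; ring
    simp only [key]
    rw [intervalIntegral.integral_const_mul, if_neg (Nat.succ_ne_zero n)]
    refine mul_eq_zero_of_right _ ?_
    rcases n with _ | n
    · have : ∀ θ : ℝ, (sin θ * sin ((0 + 2 : ℕ) * θ) - sin θ * sin ((0 : ℕ) * θ) / 2)
          / (9 - 8 * cos θ ^ 2) = 1 / 2 * (cos ((1 : ℕ) * θ) / (9 - 8 * cos θ ^ 2))
          - 1 / 2 * (cos ((3 : ℕ) * θ) / (9 - 8 * cos θ ^ 2)) := by
        intro θ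
        push_cast
        rw [zero_mul, sin_zero, one_mul, sin_two_mul, cos_three_mul]
        have := sin_sq θ
        ring_nf
        rw [this]
        ring
      simp only [this]
      rw [intervalIntegral.integral_sub ((intervalIntegrable_poisson _ _ _).const_mul _)
        ((intervalIntegrable_poisson _ _ _).const_mul _), intervalIntegral.integral_const_mul,
        intervalIntegral.integral_const_mul]
      change 1 / 2 * poissonCoeff 1 - 1 / 2 * poissonCoeff (1 + 2) = 0
      rw [poissonCoeff_add_two, poissonCoeff_one]
      norm_num
    · have : ∀ θ : ℝ, (sin θ * sin ((n + 1 + 2 : ℕ) * θ) - sin θ * sin ((n + 1 : ℕ) * θ) / 2)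
          / (9 - 8 * cos θ ^ 2) = 3 / 4 * (cos ((n + 2 : ℕ) * θ) / (9 - 8 * cos θ ^ 2))
          - 1 / 2 * (cos ((n + 2 + 2 : ℕ) * θ) / (9 - 8 * cos θ ^ 2))
          - 1 / 4 * (cos (n * θ) / (9 - 8 * cos θ ^ 2)) := by
        intro θ
        have c1 : cos ((n + 2 : ℕ) * θ) - cos ((n + 2 + 2 : ℕ) * θ)
            = 2 * (sin θ * sin ((n + 1 + 2 : ℕ) * θ)) := by
          rw [show ((n + 2 : ℕ) : ℝ) * θ = (n + 1 + 2 : ℕ) * θ - θ by push_cast; ring,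
            show ((n + 2 + 2 : ℕ) : ℝ) * θ = (n + 1 + 2 : ℕ) * θ + θ by push_cast; ring,
            cos_sub, cos_add]
          ring
        have c2 : cos (n * θ) - cos ((n + 2 : ℕ) * θ)
            = 2 * (sin θ * sin ((n + 1 : ℕ) * θ)) := by
          rw [show (n : ℝ) * θ = (n + 1 : ℕ) * θ - θ by push_cast; ring,
            show ((n + 2 : ℕ) : ℝ) * θ = (n + 1 : ℕ) * θ + θ by push_cast; ring,
            cos_sub, cos_add]
          ring
        rw [show sin θ * sin ((n + 1 + 2 : ℕ) * θ) =
            (cos ((n + 2 : ℕ) * θ) - cos ((n + 2 + 2 : ℕ) * θ)) / 2 by rw [c1]; ring,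
          show sin θ * sin ((n + 1 : ℕ) * θ) =
            (cos (n * θ) - cos ((n + 2 : ℕ) * θ)) / 2 by rw [c2]; ring]
        ring
      simp only [this]
      rw [intervalIntegral.integral_sub (((intervalIntegrable_poisson _ _ _).const_mul _).sub
        ((intervalIntegrable_poisson _ _ _).const_mul _))
        ((intervalIntegrable_poisson _ _ _).const_mul _),
        intervalIntegral.integral_sub ((intervalIntegrable_poisson _ _ _).const_mul _)
        ((intervalIntegrable_poisson _ _ _).const_mul _), intervalIntegral.integral_const_mul,
        intervalIntegral.integral_const_mul, intervalIntegral.integral_const_mul]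
      change 3 / 4 * poissonCoeff (n + 2) - 1 / 2 * poissonCoeff (n + 2 + 2)
        - 1 / 4 * poissonCoeff n = 0
      rw [poissonCoeff_add_two (n + 2), poissonCoeff_add_two n]
      ring

/-! ### The moment recurrence -/

/-- A double sequence with the recurrence of the mixed moments of `x ^ L` and the
non-backtracking polynomial of degree `n`. -/
structure IsMomentArray (f : ℕ → ℕ → ℝ) : Prop where
  zero : ∀ L, f (L + 1) 0 = f L 1
  one : ∀ L, f (L + 1) 1 = f L 2 + 3 * f L 0
  add_two : ∀ L n, f (L + 1) (n + 2) = f L (n + 3) + 2 * f L (n + 1)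

lemma IsMomentArray.sub {f g : ℕ → ℕ → ℝ} (hf : IsMomentArray f) (hg : IsMomentArray g) :
    IsMomentArray fun L n => f L n - g L n where
  zero L := by rw [hf.zero, hg.zero]
  one L := by rw [hf.one, hg.one]; ring
  add_two L n := by rw [hf.add_two, hg.add_two]; ring

/-- The bound `4 ^ n` allowed for the initial row dominates the growth of the number of reduced
words times that of their degrees, and `4 + 3 / 4 ≤ 8` bounds the effect of one step. -/
lemma IsMomentArray.abs_le {f : ℕ → ℕ → ℝ} (hf : IsMomentArray f) {B : ℝ}
    (h0 : ∀ n, |f 0 n| ≤ B * 4 ^ n) (L n : ℕ) : |f L n| ≤ B * 4 ^ n * 8 ^ L := by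
  have hB : 0 ≤ B := by simpa using (abs_nonneg _).trans (h0 0)
  induction L generalizing n with
  | zero => simpa using h0 n
  | succ L ih =>
    have hq : 0 ≤ B * 8 ^ L := by positivity
    rcases n with _ | _ | n
    · rw [hf.zero]
      refine (ih 1).trans ?_
      rw [pow_succ (8 : ℝ)]
      linarith
    · rw [hf.one]
      refine (abs_add_le _ _).trans ?_
      rw [abs_mul, abs_of_pos (by norm_num : (0 : ℝ) < 3)]
      have h2 := ih 2
      have h1 := ih 0
      rw [pow_succ (8 : ℝ)]
      norm_num at h1 h2 ⊢
      linarith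
    · rw [hf.add_two]
      refine (abs_add_le _ _).trans ?_
      rw [abs_mul, abs_of_pos (by norm_num : (0 : ℝ) < 2)]
      have h2 := ih (n + 3)
      have h1 := ih (n + 1)
      have hq' : 0 ≤ B * 8 ^ L * 4 ^ n := by positivity
      simp only [pow_succ] at h1 h2 ⊢
      linarith

/-- The mixed moments of the Kesten-McKay measure. -/
noncomputable def kestenMcKayMoment (L n : ℕ) : ℝ :=
  ∫ x, (x ^ L * nonbacktracking n x) * kestenMcKayDensity 3 x

open Real in
lemma isMomentArray_kestenMcKayMoment : IsMomentArray kestenMcKayMoment := by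
  have hadd (L n m : ℕ) (c : ℝ) : kestenMcKayMoment L n + c * kestenMcKayMoment L m =
      ∫ x, (x ^ L * (nonbacktracking n x + c * nonbacktracking m x)) * kestenMcKayDensity 3 x := by
    have hn := continuous_nonbacktracking n
    have hm := continuous_nonbacktracking m
    have hi (F : ℝ → ℝ) (hF : Continuous F) : IntervalIntegrable
        (fun θ => F (2 * √2 * cos θ) * (12 / π * (sin θ ^ 2 / (9 - 8 * cos θ ^ 2))))
        volume 0 π := by
      have := continuous_div_nine_sub (f := fun θ => sin θ ^ 2) (by fun_prop)
      exact Continuous.intervalIntegrable (by fun_prop) _ _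
    rw [kestenMcKayMoment, kestenMcKayMoment, integral_kestenMcKay (by fun_prop),
      integral_kestenMcKay (by fun_prop), integral_kestenMcKay (by fun_prop),
      ← intervalIntegral.integral_const_mul, ← intervalIntegral.integral_add
      (hi (fun x => x ^ L * nonbacktracking n x) (by fun_prop))
      ((hi (fun x => x ^ L * nonbacktracking m x) (by fun_prop)).const_mul c)]
    congr 1
    ext θ
    ring
  constructor
  · intro L
    simp only [kestenMcKayMoment, nonbacktracking, pow_succ, mul_one]
  · intro L
    rw [hadd, kestenMcKayMoment]
    congr 1
    ext x
    simp only [nonbacktracking]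
    ring
  · intro L n
    rw [hadd, kestenMcKayMoment]
    congr 1
    ext x
    simp only [nonbacktracking]
    ring

lemma kestenMcKayMoment_zero_left (n : ℕ) : kestenMcKayMoment 0 n = if n = 0 then 1 else 0 := by
  simp only [kestenMcKayMoment, pow_zero, one_mul, integral_nonbacktracking]

lemma kestenMcKayMoment_zero_right (L : ℕ) :
    kestenMcKayMoment L 0 = ∫ x, x ^ L * kestenMcKayDensity 3 x := by
  simp only [kestenMcKayMoment, nonbacktracking, mul_one]

/-! ### Moments of the eigenvalue measure -/

/-- The moments of the eigenvalue measure are normalized traces. -/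
lemma integral_pow_markoffEigenvalueMeasure (p : ℕ) [NeZero p] (L : ℕ) :
    ∫ x, x ^ L ∂(markoffEigenvalueMeasure p) =
      (markoffAdjMatrix p ^ L).trace / Fintype.card (MarkoffVertex p) := by
  have htr : (markoffAdjMatrix p ^ L).trace =
      ∑ j, (markoffAdjMatrix_isHermitian p).eigenvalues j ^ L := by
    conv_lhs => rw [(markoffAdjMatrix_isHermitian p).spectral_theorem, ← map_pow,
      Unitary.conjStarAlgAut_apply, Matrix.trace_mul_cycle, Unitary.coe_star_mul_self, one_mul,
      Matrix.diagonal_pow, Matrix.trace_diagonal]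
    rfl
  rw [markoffEigenvalueMeasure, integral_smul_measure,
    integral_finsetSum_measure fun j _ => integrable_dirac (by simp)]
  simp only [integral_dirac]
  rw [htr, smul_eq_mul, ENNReal.toReal_inv, ENNReal.toReal_natCast, div_eq_inv_mul]

/-! ### Sums over reduced words -/

section NonbacktrackingMatrix

variable {p : ℕ}

/-- The reduced words of length `n + 1` whose last letter to act is `i`. -/
def reducedWords : ℕ → Fin 3 → List (List (Fin 3))
  | 0, i => [[i]]
  | n + 1, i => (reducedWords n (i + 1) ++ reducedWords n (i + 2)).map (i :: ·)

lemma length_reducedWords (n : ℕ) (i : Fin 3) : (reducedWords n i).length = 2 ^ n := by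
  induction n generalizing i with
  | zero => rfl
  | succ n ih =>
    rw [reducedWords, List.length_map, List.length_append, ih, ih, pow_succ, mul_two]

lemma reducedWord_of_mem {n : ℕ} {i : Fin 3} {l : List (Fin 3)} (h : l ∈ reducedWords n i) :
    l.length = n + 1 ∧ ∃ k, ReducedWord k i l := by
  induction n generalizing i l with
  | zero =>
    obtain rfl : l = [i] := by simpa [reducedWords] using h
    exact ⟨rfl, i, .singleton⟩
  | succ n ih =>
    obtain ⟨l', hl', rfl⟩ := List.mem_map.mp h
    rcases List.mem_append.mp hl' with h' | h'
    · obtain ⟨h1, k, h2⟩ := ih h'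
      exact ⟨by simp [h1], k, h2.cons (Fin.add_one_ne_self_three i).symm⟩
    · obtain ⟨h1, k, h2⟩ := ih h'
      exact ⟨by simp [h1], k, h2.cons (Fin.add_two_ne_self_three i).symm⟩

variable [Fact p.Prime] [DecidableEq (MarkoffVertex p)]

/-- The sum of the permutation matrices of the reduced words of length `n + 1` whose last letter
to act is `i`. -/
noncomputable def reducedWordMatrix (p : ℕ) [Fact p.Prime] [DecidableEq (MarkoffVertex p)]
    (n : ℕ) (i : Fin 3) : Matrix (MarkoffVertex p) (MarkoffVertex p) ℝ :=
  ((reducedWords n i).map fun l => (vietaWordPerm l).permMatrix ℝ).sum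

lemma reducedWordMatrix_zero (i : Fin 3) :
    reducedWordMatrix p 0 i = (vietaPerm i).permMatrix ℝ := by
  simp [reducedWordMatrix, reducedWords, vietaWordPerm]

lemma reducedWordMatrix_succ (n : ℕ) (i : Fin 3) :
    reducedWordMatrix p (n + 1) i =
      (reducedWordMatrix p n (i + 1) + reducedWordMatrix p n (i + 2)) *
        (vietaPerm i).permMatrix ℝ := by
  rw [reducedWordMatrix, reducedWordMatrix, reducedWordMatrix, reducedWords, ← List.sum_append,
    ← List.map_append, ← List.sum_map_mul_right, List.map_map]
  congr 2
  ext1 l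
  simp only [Function.comp_apply, vietaWordPerm, List.map_cons, List.prod_cons,
    Matrix.permMatrix_mul]

lemma vietaPerm_mul_self {p : ℕ} (i : Fin 3) :
    (vietaPerm i : Equiv.Perm (MarkoffVertex p)) * vietaPerm i = 1 := by
  ext1 v
  apply MarkoffVertex.coords_injective
  rw [Equiv.Perm.mul_apply, coords_vietaPerm, coords_vietaPerm, vietaMove_vietaMove]
  rfl

lemma permMatrix_vietaPerm_mul_self (i : Fin 3) :
    (vietaPerm i : Equiv.Perm (MarkoffVertex p)).permMatrix ℝ * (vietaPerm i).permMatrix ℝ = 1 := by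
  rw [← Matrix.permMatrix_mul, vietaPerm_mul_self, Matrix.permMatrix_one]

/-- The sum of the permutation matrices of all reduced words of length `n`. -/
noncomputable def nonbacktrackingMatrix (p : ℕ) [Fact p.Prime] [DecidableEq (MarkoffVertex p)] :
    ℕ → Matrix (MarkoffVertex p) (MarkoffVertex p) ℝ
  | 0 => 1
  | n + 1 => ∑ i, reducedWordMatrix p n i

/-- In odd characteristic the edges of the Markoff graph have no multiplicities: a vertex fixed by
the involutions of two coordinates `x` and `y` satisfies `2x = yz` and `2y = xz`, hence
`x (z² - 4) = 0`, which is impossible for a nonzero point of the surface. -/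
lemma vietaPerm_apply_ne {p : ℕ} [Fact p.Prime] (hp : p ≠ 2) {i j : Fin 3} (hij : i ≠ j)
    (v : MarkoffVertex p) : vietaPerm i v ≠ vietaPerm j v := by
  -- It is enough to treat two cyclically consecutive coordinates.
  suffices H : ∀ i : Fin 3, vietaPerm i v ≠ vietaPerm (i + 1) v by
    rcases Fin.eq_or_eq_add_one_or_eq_add_two i j with rfl | rfl | rfl
    · exact absurd rfl hij
    · exact H i
    · have := (H (i + 2)).symm
      rwa [Fin.add_two_add_one_three] at this
  intro i h
  have h2 : (2 : ZMod p) ≠ 0 := by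
    intro h
    have h' : ((2 : ℕ) : ZMod p) = 0 := by exact_mod_cast h
    rw [ZMod.natCast_eq_zero_iff] at h'
    exact hp ((Nat.prime_dvd_prime_iff_eq Fact.out Nat.prime_two).mp h')
  have hc : vietaMove i v.coords = vietaMove (i + 1) v.coords := by
    rw [← coords_vietaPerm, ← coords_vietaPerm, h]
  have e1 := congrFun hc i
  have e2 := congrFun hc (i + 1)
  rw [vietaMove, vietaMove, Function.update_self,
    Function.update_of_ne (Fin.add_one_ne_self_three i).symm] at e1
  rw [vietaMove, vietaMove, Function.update_self,
    Function.update_of_ne (Fin.add_one_ne_self_three i), Fin.add_one_add_one_three,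
    Fin.add_one_add_two_three] at e2
  have hM := v.isMarkoffTriple_coords i
  have h0 := v.coords_ne_zero
  set x := v.coords i
  set y := v.coords (i + 1)
  set z := v.coords (i + 2)
  apply h0
  have hx : x * (z ^ 2 - 4) = 0 := by linear_combination 2 * e1 - z * e2
  have hx0 : x = 0 := by
    rcases mul_eq_zero.mp hx with h | h
    · exact h
    · exfalso
      have hz2 : z ^ 2 = 0 := mul_left_cancel₀ h2 <| by
        linear_combination 2 * hM + x * e1 - y * e2
      have h4 : (2 : ZMod p) ^ 2 = 0 := by linear_combination hz2 - h
      exact h2 (pow_eq_zero_iff two_ne_zero |>.mp h4)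
  have hy0 : y = 0 := by
    have : 2 * y = 0 := by rw [hx0] at e2; linear_combination e2
    exact (mul_eq_zero.mp this).resolve_left h2
  have hz0 : z = 0 := by
    rw [hx0, hy0] at hM
    have : z ^ 2 = 0 := by linear_combination hM
    exact pow_eq_zero_iff two_ne_zero |>.mp this
  ext a
  rcases Fin.eq_or_eq_add_one_or_eq_add_two i a with rfl | rfl | rfl
  · exact hx0
  · exact hy0
  · exact hz0

lemma markoffAdjMatrix_eq_sum (hp : p ≠ 2) :
    markoffAdjMatrix p = ∑ i, (vietaPerm i).permMatrix ℝ := by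
  ext v w
  simp only [markoffAdjMatrix, Matrix.of_apply, Matrix.sum_apply, Equiv.Perm.permMatrix,
    PEquiv.toMatrix_apply, Equiv.toPEquiv_apply, Option.mem_def, Option.some.injEq]
  split_ifs with h
  · obtain ⟨i, rfl⟩ := markoffAdj_iff.mp h
    rw [Finset.sum_eq_single i, if_pos rfl]
    · intro j _ hj
      rw [if_neg (vietaPerm_apply_ne hp hj v)]
    · simp
  · refine (Finset.sum_eq_zero fun i _ => if_neg fun hi => h ?_).symm
    exact markoffAdj_iff.mpr ⟨i, hi⟩

lemma nonbacktrackingMatrix_one (hp : p ≠ 2) : nonbacktrackingMatrix p 1 = markoffAdjMatrix p := by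
  simp only [markoffAdjMatrix_eq_sum hp, nonbacktrackingMatrix, reducedWordMatrix_zero]

lemma Fin.sum_univ_eq_add_add {M : Type*} [AddCommMonoid M] (f : Fin 3 → M) (i : Fin 3) :
    ∑ j, f j = f i + f (i + 1) + f (i + 2) := by
  rw [Fin.sum_univ_three]
  fin_cases i
  · simp
  · simp; abel
  · simp; abel

/-- Appending a letter to a reduced word of length `n + 1` either gives a reduced word of length
`n + 2` or cancels the last letter. -/
lemma nonbacktrackingMatrix_succ_mul (hp : p ≠ 2) (n : ℕ) :
    nonbacktrackingMatrix p (n + 1) * markoffAdjMatrix p =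
      nonbacktrackingMatrix p (n + 2) +
        ∑ i, reducedWordMatrix p n i * (vietaPerm i).permMatrix ℝ := by
  rw [markoffAdjMatrix_eq_sum hp, Finset.mul_sum]
  simp only [nonbacktrackingMatrix, reducedWordMatrix_succ]
  rw [← Finset.sum_add_distrib]
  refine Finset.sum_congr rfl fun i _ => ?_
  rw [Fin.sum_univ_eq_add_add _ i, ← add_mul]
  congr 1
  abel

lemma nonbacktrackingMatrix_one_mul (hp : p ≠ 2) :
    nonbacktrackingMatrix p 1 * markoffAdjMatrix p =
      nonbacktrackingMatrix p 2 + (3 : ℝ) • nonbacktrackingMatrix p 0 := by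
  rw [nonbacktrackingMatrix_succ_mul hp 0]
  simp only [reducedWordMatrix_zero, permMatrix_vietaPerm_mul_self, Finset.sum_const,
    Finset.card_univ, Fintype.card_fin, nonbacktrackingMatrix]
  rw [← Nat.cast_smul_eq_nsmul ℝ]
  norm_num

lemma nonbacktrackingMatrix_add_two_mul (hp : p ≠ 2) (n : ℕ) :
    nonbacktrackingMatrix p (n + 2) * markoffAdjMatrix p =
      nonbacktrackingMatrix p (n + 3) + (2 : ℝ) • nonbacktrackingMatrix p (n + 1) := by
  rw [nonbacktrackingMatrix_succ_mul hp (n + 1)]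
  congr 1
  simp only [reducedWordMatrix_succ, mul_assoc, permMatrix_vietaPerm_mul_self, mul_one,
    nonbacktrackingMatrix]
  simp only [Fin.sum_univ_three, two_smul]
  simp
  abel

lemma isMomentArray_trace (hp : p ≠ 2) (m : ℝ) :
    IsMomentArray fun L n => (nonbacktrackingMatrix p n * markoffAdjMatrix p ^ L).trace / m where
  zero L := by
    rw [pow_succ', ← mul_assoc, nonbacktrackingMatrix_one hp]
    simp only [nonbacktrackingMatrix, one_mul]
  one L := by
    rw [pow_succ', ← mul_assoc, nonbacktrackingMatrix_one_mul hp, add_mul, smul_mul_assoc,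
      Matrix.trace_add, Matrix.trace_smul, smul_eq_mul]
    ring
  add_two L n := by
    rw [pow_succ', ← mul_assoc, nonbacktrackingMatrix_add_two_mul hp, add_mul, smul_mul_assoc,
      Matrix.trace_add, Matrix.trace_smul, smul_eq_mul]
    ring

lemma abs_trace_reducedWordMatrix_le (n : ℕ) (i : Fin 3) :
    |(reducedWordMatrix p n i).trace| ≤ 2 ^ n * (2 ^ (n + 4) * p) := by
  have key : ∀ l ∈ reducedWords n i,
      |((vietaWordPerm l : Equiv.Perm (MarkoffVertex p)).permMatrix ℝ).trace|
        ≤ 2 ^ (n + 4) * p := by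
    intro l hl
    obtain ⟨hlen, k, hk⟩ := reducedWord_of_mem hl
    have := hk.card_fixed_le (p := p)
    rw [hlen] at this
    rw [Matrix.trace_permutation, Nat.abs_cast, Set.ncard_eq_toFinset_card']
    have e : (Function.fixedPoints (vietaWordPerm l : Equiv.Perm (MarkoffVertex p))).toFinset =
        Finset.univ.filter fun v : MarkoffVertex p => vietaWordPerm l v = v := by
      ext v; simp [Function.mem_fixedPoints, Function.IsFixedPt]
    rw [e]
    exact_mod_cast this
  have hlen : (2 : ℝ) ^ n = (reducedWords n i).length := by
    rw [length_reducedWords]; push_cast; rfl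
  rw [hlen, reducedWordMatrix]
  generalize reducedWords n i = w at key
  induction w with
  | nil => simp
  | cons l w ih =>
    rw [List.map_cons, List.sum_cons, Matrix.trace_add, List.length_cons]
    refine (abs_add_le _ _).trans ?_
    have h1 := key l List.mem_cons_self
    have h2 := ih fun l' hl' => key l' (List.mem_cons_of_mem _ hl')
    push_cast
    linarith

lemma abs_trace_nonbacktrackingMatrix_le (n : ℕ) :
    |(nonbacktrackingMatrix p (n + 1)).trace| ≤ 12 * 4 ^ (n + 1) * p := by
  rw [nonbacktrackingMatrix, Matrix.trace_sum]
  calc _ ≤ ∑ i, |(reducedWordMatrix p n i).trace| := Finset.abs_sum_le_sum_abs _ _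
    _ ≤ ∑ _i : Fin 3, (2 : ℝ) ^ n * (2 ^ (n + 4) * p) :=
        Finset.sum_le_sum fun i _ => abs_trace_reducedWordMatrix_le n i
    _ = 12 * 4 ^ (n + 1) * p := by
        rw [Finset.sum_const, Finset.card_univ, Fintype.card_fin, nsmul_eq_mul,
          show (4 : ℝ) = 2 ^ 2 by norm_num, ← pow_mul]
        push_cast
        ring

end NonbacktrackingMatrix

/-! ### Bounds on the moments -/

/-- The case of large `p`, in which the traces of the non-backtracking matrices are
`O(4 ^ n * p)` and the number of vertices is at least of the order of `p ^ 2`. -/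
lemma abs_moment_sub_le_of_large {p : ℕ} [Fact p.Prime] (hp : 11 ≤ p) (L : ℕ) :
    |(markoffAdjMatrix p ^ L).trace / Fintype.card (MarkoffVertex p) - kestenMcKayMoment L 0|
      ≤ 96 / p * 8 ^ L := by
  classical
  set m : ℝ := ((Fintype.card (MarkoffVertex p) : ℕ) : ℝ) with hm
  have hp' : (11 : ℝ) ≤ p := by exact_mod_cast hp
  have hcard : (p : ℝ) ^ 2 ≤ 8 * m := by
    have h : (((p - 5) * (p - 1) : ℕ) : ℝ) ≤ ((2 * Fintype.card (MarkoffVertex p) : ℕ) : ℝ) := by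
      exact_mod_cast le_card_markoffVertex (p := p)
    push_cast [Nat.cast_sub (show 5 ≤ p by omega), Nat.cast_sub (show 1 ≤ p by omega)] at h
    nlinarith
  have hm0 : 0 < m := by nlinarith
  have hE := (isMomentArray_trace (p := p) (by omega) m).sub isMomentArray_kestenMcKayMoment
  have h0 (n : ℕ) : |(nonbacktrackingMatrix p n * markoffAdjMatrix p ^ 0).trace / m
      - kestenMcKayMoment 0 n| ≤ 96 / p * 4 ^ n := by
    rw [pow_zero, mul_one, kestenMcKayMoment_zero_left]
    rcases n with _ | n
    · rw [if_pos rfl, nonbacktrackingMatrix, Matrix.trace_one, ← hm, div_self hm0.ne', sub_self,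
        abs_zero]
      positivity
    · rw [if_neg (Nat.succ_ne_zero n), sub_zero, abs_div, abs_of_pos hm0, div_le_iff₀ hm0]
      refine (abs_trace_nonbacktrackingMatrix_le n).trans ?_
      have h4 : (0 : ℝ) < 4 ^ (n + 1) := by positivity
      have hpm : (p : ℝ) ≤ 8 * m / p := by
        rw [le_div_iff₀ (by linarith)]
        nlinarith
      calc 12 * 4 ^ (n + 1) * (p : ℝ) ≤ 12 * 4 ^ (n + 1) * (8 * m / p) := by gcongr
        _ = 96 / p * 4 ^ (n + 1) * m := by ring
  have := hE.abs_le h0 L 0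
  simpa [nonbacktrackingMatrix] using this

lemma abs_matrix_pow_apply_le {n : Type*} [Fintype n] [DecidableEq n] {A : Matrix n n ℝ}
    (hA : ∀ i j, |A i j| ≤ 1) (L : ℕ) (i j : n) : |(A ^ L) i j| ≤ (Fintype.card n : ℝ) ^ L := by
  induction L generalizing i j with
  | zero => rw [pow_zero, pow_zero, Matrix.one_apply]; split_ifs <;> simp
  | succ L ih =>
    rw [pow_succ, Matrix.mul_apply]
    calc _ ≤ ∑ a, |(A ^ L) i a * A a j| := Finset.abs_sum_le_sum_abs _ _
      _ ≤ ∑ _a : n, (Fintype.card n : ℝ) ^ L := by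
          refine Finset.sum_le_sum fun a _ => ?_
          rw [abs_mul]
          exact mul_le_of_le_one_right (abs_nonneg _) (hA a j) |>.trans (ih i a)
      _ = (Fintype.card n : ℝ) ^ (L + 1) := by
          rw [Finset.sum_const, Finset.card_univ, nsmul_eq_mul, pow_succ, mul_comm]

lemma abs_trace_markoffAdjMatrix_pow_div_le (p : ℕ) [NeZero p] (L : ℕ) :
    |(markoffAdjMatrix p ^ L).trace / Fintype.card (MarkoffVertex p)| ≤ ((p : ℝ) ^ 3) ^ L := by
  have hA (v w : MarkoffVertex p) : |markoffAdjMatrix p v w| ≤ 1 := by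
    simp only [markoffAdjMatrix, Matrix.of_apply]
    split_ifs <;> simp
  have hcard : (Fintype.card (MarkoffVertex p) : ℝ) ≤ (p : ℝ) ^ 3 := by
    have := Fintype.card_subtype_le fun v : ZMod p × ZMod p × ZMod p =>
      v ≠ (0, 0, 0) ∧ v.1 ^ 2 + v.2.1 ^ 2 + v.2.2 ^ 2 = v.1 * v.2.1 * v.2.2
    rw [Fintype.card_prod, Fintype.card_prod, ZMod.card] at this
    have h' : Fintype.card (MarkoffVertex p) ≤ p ^ 3 := by rw [pow_three]; exact this
    exact_mod_cast h'
  rw [abs_div, Nat.abs_cast]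
  refine div_le_of_le_mul₀ (by positivity) (by positivity) ?_
  calc _ ≤ ∑ v, |(markoffAdjMatrix p ^ L) v v| := Finset.abs_sum_le_sum_abs _ _
    _ ≤ ∑ _v : MarkoffVertex p, ((p : ℝ) ^ 3) ^ L := Finset.sum_le_sum fun v _ =>
        (abs_matrix_pow_apply_le hA L v v).trans (by gcongr)
    _ = ((p : ℝ) ^ 3) ^ L * Fintype.card (MarkoffVertex p) := by
        rw [Finset.sum_const, Finset.card_univ, nsmul_eq_mul, mul_comm]

lemma abs_kestenMcKayMoment_le (L : ℕ) : |kestenMcKayMoment L 0| ≤ 8 ^ L := by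
  have := isMomentArray_kestenMcKayMoment.abs_le (B := 1) (fun n => by
    rw [kestenMcKayMoment_zero_left, one_mul]
    split_ifs
    · rw [abs_one]; exact one_le_pow₀ (by norm_num)
    · rw [abs_zero]; positivity) L 0
  simpa using this

theorem theorem1 :
    ∃ K : ℝ, 0 < K ∧ ∀ (p : ℕ) [Fact p.Prime], p ≠ 3 → ∀ L : ℕ,
      |(∫ x, x ^ L ∂(markoffEigenvalueMeasure p)) - ∫ x, x ^ L * kestenMcKayDensity 3 x|
        ≤ K * ((2 ^ 17 : ℝ) ^ L / p) := by
  refine ⟨96, by norm_num, fun p _ _ L => ?_⟩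
  rw [integral_pow_markoffEigenvalueMeasure, ← kestenMcKayMoment_zero_right]
  have hp0 : (0 : ℝ) < p := by exact_mod_cast (Fact.out : p.Prime).pos
  have h8 : (8 : ℝ) ^ L ≤ (2 ^ 17) ^ L := by gcongr; norm_num
  rcases le_or_gt 11 p with hp | hp
  · calc _ ≤ 96 / (p : ℝ) * 8 ^ L := abs_moment_sub_le_of_large hp L
      _ ≤ 96 / (p : ℝ) * (2 ^ 17) ^ L := by gcongr
      _ = _ := by ring
  · -- For small `p` both moments are bounded by `(2 ^ 17) ^ L`, since `p ^ 3 ≤ 2 ^ 17`.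
    have hp' : (p : ℝ) ≤ 11 := by exact_mod_cast hp.le
    have h1 : ((p : ℝ) ^ 3) ^ L ≤ (2 ^ 17) ^ L := by
      gcongr
      calc (p : ℝ) ^ 3 ≤ 11 ^ 3 := by gcongr
        _ ≤ 2 ^ 17 := by norm_num
    calc _ ≤ ((p : ℝ) ^ 3) ^ L + 8 ^ L := (abs_sub _ _).trans
          (add_le_add (abs_trace_markoffAdjMatrix_pow_div_le p L) (abs_kestenMcKayMoment_le L))
      _ ≤ 2 * (2 ^ 17) ^ L := by linarith
      _ ≤ 96 / (p : ℝ) * (2 ^ 17) ^ L := by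
          gcongr
          rw [le_div_iff₀ hp0]
          linarith
      _ = _ := by ring
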